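/- Let $\Gamma$ be a finite simplicial graph (no loops, no multiple edges) with vertex set $V$. A clique is a set of pairwise adjacent vertices (the empty set is a clique), a $k$-clique is a clique with $k$ elements, and the link of a clique $\sigma$ is $\mathrm{Lk}(\sigma)=\{v\in V\setminus\sigma : \{v\}\cup\sigma \text{ is a clique}\}$. Assume that $\Gamma$ is link-regular, i.e. $|\mathrm{Lk}(\sigma_1)|=|\mathrm{Lk}(\sigma_2)|$ whenever $\sigma_1,\sigma_2$ are cliques with $|\sigma_1|=|\sigma_2|$. Let $d$ be the maximum size of a clique of $\Gamma$, let $\ell_0=|V|$, and for $1\le k\le d$ let $\ell_k=|\mathrm{Lk}(\sigma)|$, where $\sigma$ is any $k$-clique. For integers $0\le k\le m\le d$ set \[ N_{m,k}=\begin{cases} \left(\prod_{k<j<m}\ell_j\right)\sum_{j=k}^m\binom{m-k}{j-k}(-1)^{j-k}\ell_j & \text{if } k<m-1,\\ \ell_{m-1}-\ell_m-1 & \text{if } k=m-1,\\ 1 & \text{if } k=m, \end{cases} \] and for integers $0\le j\le i\le d$ set $M_{i,j}=1$ if $i=j$, and if $i\ne j$ \[ M_{i,j}=\sum (-1)^n\binom{t_1}{s_1}\cdots\binom{t_n}{s_n}\,N_{t_1,s_1}\cdots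 N_{t_n,s_n}, \] where the sum is over all $n\ge 1$ and all integers $j\le s_1<t_1\le s_2<t_2\le\cdots\le s_n<t_n\le d$ with $(t_1-s_1)+\cdots+(t_n-s_n)=i-j$. Let $\mathrm{RACG}(\Gamma)=\langle v\in V \mid v^2=1 \text{ for } v\in V,\ uv=vu \text{ for every edge } \{u,v\}\rangle$ be the right-angled Coxeter group of $\Gamma$, with standard generating set $S=V\cup V^{-1}$ (which equals $V$). A word over $S$ is geodesic if no shorter word over $S$ represents the same group element; the geodesic growth series $\mathcal{G}(z)$ of $\mathrm{RACG}(\Gamma)$ is the formal power series whose $z^n$-coefficient is the number of geodesic words of length $n$. Then \[ \mathcal{G}(z)=\frac{\sum_{i=0}^d\left(\sum_{j=0}^i \ell_0\cdots\ell_{j-1}\,M_{i,j}\right)z^i}{\sum_{i=0}^d M_{i,0}\,z^i}, \] where the denominator has constant term $1$, so that the quotient is a well-defined formal power series. -/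

import Mathlib

open scoped Polynomial PowerSeries

/-- The growth series `∑ |L ∩ Aⁿ| zⁿ` of a language `L` over a finite alphabet `A`. -/
noncomputable def growthSeries {A : Type*} [Finite A] (L : Language A) : ℚ⟦X⟧ :=
  PowerSeries.mk fun n => (Set.ncard {x : List A | x ∈ L ∧ x.length = n} : ℚ)

/-- The value in the group `G` of a word over the subset `S` of `G`. -/
def wordValue {G : Type*} [Group G] {S : Set G} (x : List S) : G :=
  (x.map Subtype.val).prod

/-- The geodesic language of `(G, S)`: the words over `S` such that no shorter word over `S` has
the same value in `G`. -/
def geodesicLanguage {G : Type*} [Group G] (S : Set G) : Language S :=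
  {x : List S | ∀ y : List S, wordValue y = wordValue x → x.length ≤ y.length}

/-- The defining relators of a numbered graph product: `v ^ N v` for every vertex `v`, and the
commutator of `u` and `v` for every edge `{u, v}`. -/
def graphProductRelators {V : Type*} (Γ : SimpleGraph V) (N : V → ℕ) : Set (FreeGroup V) :=
  {r | ∃ v, r = FreeGroup.of v ^ N v} ∪
    {r | ∃ u v, Γ.Adj u v ∧
      r = FreeGroup.of u * FreeGroup.of v * (FreeGroup.of u)⁻¹ * (FreeGroup.of v)⁻¹}

/-- The numbered graph product of the cyclic groups of orders `N v` over the graph `Γ`. -/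
abbrev NumberedGraphProduct {V : Type*} (Γ : SimpleGraph V) (N : V → ℕ) : Type _ :=
  PresentedGroup (graphProductRelators Γ N)

/-- The standard generating set: the vertices and their inverses, as elements of the group. -/
def NumberedGraphProduct.standardGenerators {V : Type*} (Γ : SimpleGraph V) (N : V → ℕ) :
    Set (NumberedGraphProduct Γ N) :=
  {g | ∃ v : V, g = PresentedGroup.of v ∨ g = (PresentedGroup.of v)⁻¹}

instance NumberedGraphProduct.finite_standardGenerators {V : Type*} [Finite V]
    (Γ : SimpleGraph V) (N : V → ℕ) :
    Finite (NumberedGraphProduct.standardGenerators Γ N) := by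
  refine Set.Finite.to_subtype (Set.Finite.subset
    ((Set.finite_range fun v : V => (PresentedGroup.of v : NumberedGraphProduct Γ N)).union
      (Set.finite_range fun v : V => (PresentedGroup.of v : NumberedGraphProduct Γ N)⁻¹)) ?_)
  rintro g ⟨v, rfl | rfl⟩
  · exact Or.inl ⟨v, rfl⟩
  · exact Or.inr ⟨v, rfl⟩

/-- The right-angled Coxeter group of a graph: all vertex numbers are `2`. -/
abbrev RACG {V : Type*} (Γ : SimpleGraph V) : Type _ :=
  NumberedGraphProduct Γ fun _ => 2

/-- The standard generating set of the right-angled Coxeter group of `Γ`. -/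
abbrev RACG.standardGenerators {V : Type*} (Γ : SimpleGraph V) : Set (RACG Γ) :=
  NumberedGraphProduct.standardGenerators Γ fun _ => 2

/-- The geodesic growth series of the right-angled Coxeter group of a finite graph, with respect
to its standard generating set. -/
noncomputable def RACG.geodesicGrowthSeries {V : Type*} [Finite V] (Γ : SimpleGraph V) : ℚ⟦X⟧ :=
  growthSeries (geodesicLanguage (RACG.standardGenerators Γ))

open Classical in
/-- The link of a clique `σ`: the vertices outside `σ` that form a clique together with `σ`. -/
noncomputable def SimpleGraph.cliqueLink {V : Type*} [Fintype V] (Γ : SimpleGraph V)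
    (σ : Finset V) : Finset V :=
  {v | v ∉ σ ∧ Γ.IsClique ((insert v σ : Finset V) : Set V)}

/-- Cliques of the same size have links of the same size. -/
def SimpleGraph.IsLinkRegular {V : Type*} [Fintype V] (Γ : SimpleGraph V) : Prop :=
  ∀ σ₁ σ₂ : Finset V, Γ.IsClique (σ₁ : Set V) → Γ.IsClique (σ₂ : Set V) →
    σ₁.card = σ₂.card → (Γ.cliqueLink σ₁).card = (Γ.cliqueLink σ₂).card

/-- The integer `N_{m,k}` (meaningful for `k ≤ m`). -/
def coeffN (ℓ : ℕ → ℕ) (m k : ℕ) : ℤ :=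
  if k = m then 1
  else if k + 1 = m then (ℓ (m - 1) : ℤ) - ℓ m - 1
  else (∏ j ∈ Finset.Ioo k m, (ℓ j : ℤ)) *
    ∑ j ∈ Finset.Icc k m, ((m - k).choose (j - k) : ℤ) * (-1) ^ (j - k) * ℓ j

/-- For `s = (s₁, …, sₙ)` and `t = (t₁, …, tₙ)`, the conditions
`j ≤ s₁ < t₁ ≤ s₂ < t₂ ≤ ⋯ ≤ sₙ < tₙ ≤ d` and `(t₁ - s₁) + ⋯ + (tₙ - sₙ) = i - j`. -/
def IsInterlacing (d i j n : ℕ) (s t : Fin n → ℕ) : Prop :=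
  (∀ a, j ≤ s a ∧ s a < t a ∧ t a ≤ d) ∧ (∀ a b, a < b → t a ≤ s b) ∧
    ∑ a, (t a - s a) = i - j

open Classical in
/-- The integer `M_{i,j}` (meaningful for `j ≤ i ≤ d`). The number `n` of pairs may be bounded by
`d`, because each pair `s < t` takes up at least one unit of the interval from `0` to `d`. -/
noncomputable def coeffM (ℓ : ℕ → ℕ) (d i j : ℕ) : ℤ :=
  if i = j then 1
  else ∑ n ∈ Finset.range (d + 1),
    ∑ p ∈ (Fintype.piFinset fun _ : Fin n =>
        Finset.range (d + 1) ×ˢ Finset.range (d + 1)) with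
          IsInterlacing d i j n (fun a => (p a).1) (fun a => (p a).2),
      (-1) ^ n * ∏ a, (((p a).2.choose (p a).1 : ℤ) * coeffN ℓ (p a).2 (p a).1)

/-- The numerator `∑_{i ≤ d} (∑_{j ≤ i} ℓ₀ ⋯ ℓ_{j-1} M_{i,j}) zⁱ`. -/
noncomputable def growthNumerator (ℓ : ℕ → ℕ) (d : ℕ) : ℚ[X] :=
  ∑ i ∈ Finset.range (d + 1),
    Polynomial.C (((∑ j ∈ Finset.range (i + 1),
      (∏ r ∈ Finset.range j, (ℓ r : ℤ)) * coeffM ℓ d i j : ℤ)) : ℚ) * Polynomial.X ^ i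

/-- The denominator `∑_{i ≤ d} M_{i,0} zⁱ`. -/
noncomputable def growthDenominator (ℓ : ℕ → ℕ) (d : ℕ) : ℚ[X] :=
  ∑ i ∈ Finset.range (d + 1), Polynomial.C ((coeffM ℓ d i 0 : ℤ) : ℚ) * Polynomial.X ^ i

/-! Geodesics are read from right to left. If `σ` is the left descent set of a group element `g`,
then `σ` is a clique, `v * g` is longer than `g` exactly when `v ∉ σ`, and the descent set of `v *
g` is then `v` together with the neighbours of `v` in `σ`. Thus geodesics are the paths from `∅` in
a deterministic automaton whose states are cliques (`isGeodesicWord_iff`, `extends_reverse`). That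
words accepted by the automaton are geodesic is seen from the signs of the coordinates of a chamber
point in the dual geometric representation (`chamberPoint_pos`).

By link-regularity and inclusion-exclusion, the number of letters leading from a `k`-clique to a
`(j+1)`-clique depends only on `k` and `j` (`card_filter_card_eq`). So the series `E_k` of
continuations from a `k`-clique satisfy `E_k = 1 + z ∑_{j ≤ k} C(k,j) T_{k,j} E_{j+1}` with `T_{k,k}
= ℓ_k`. Put `c_k = ℓ_0⋯ℓ_{k-1} z^k` and `H_k = c_k E_k`: then `H_k = c_k + H_{k+1} + ∑_{j<k} C(k,j)
N_{k,j} z^{k-j} H_{j+1}`, and `H_{d+1} = 0` because `ℓ_d = 0`.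

The generating polynomials `D_j = ∑_i M_{i,j} z^{i-j}` of interval sequences solve the adjoint
recurrence (`intervalsPoly_eq_add`). Pairing the two systems telescopes to `E_0 D_0 = ∑_k c_k D_k`,
which is the claim. -/

namespace SimpleGraph

/-! ### The dual geometric representation and the generators -/

variable {V : Type*} (Γ : SimpleGraph V)

open Classical in
/-- The action of the standard generator `v` on the dual of the geometric representation. -/
noncomputable def reflect (v : V) (f : V → ℤ) : V → ℤ := fun x =>
  if x = v then -f v else if Γ.Adj v x then f x else f x + 2 * f v

theorem reflect_self (v : V) (f : V → ℤ) : Γ.reflect v f v = -f v := by simp [reflect]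

theorem reflect_of_adj {v x : V} (h : Γ.Adj v x) (f : V → ℤ) : Γ.reflect v f x = f x := by
  simp [reflect, h, h.ne']

theorem reflect_of_not_adj {v x : V} (hne : x ≠ v) (h : ¬ Γ.Adj v x) (f : V → ℤ) :
    Γ.reflect v f x = f x + 2 * f v := by
  simp [reflect, h, hne]

theorem reflect_involutive (v : V) : Function.Involutive (Γ.reflect v) := by
  intro f
  funext x
  by_cases hx : x = v
  · subst hx
    simp [reflect_self]
  · by_cases h : Γ.Adj v x
    · simp [reflect_of_adj, h]
    · simp [reflect_of_not_adj, h, hx, reflect_self]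

theorem reflect_comm {u v : V} (huv : Γ.Adj u v) (f : V → ℤ) :
    Γ.reflect u (Γ.reflect v f) = Γ.reflect v (Γ.reflect u f) := by
  have hne := huv.ne
  have hvu := huv.symm
  funext x
  by_cases hxu : x = u
  · subst hxu
    simp [reflect_self, reflect_of_adj, hvu]
  by_cases hxv : x = v
  · subst hxv
    simp [reflect_self, reflect_of_adj, huv]
  by_cases h1 : Γ.Adj u x <;> by_cases h2 : Γ.Adj v x <;>
    simp [reflect_of_adj, reflect_of_not_adj, h1, h2, hxu, hxv, huv, hvu]
  ring

/-- The dual geometric representation of the right-angled Coxeter group. -/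
noncomputable def dualRep : RACG Γ →* Equiv.Perm (V → ℤ) :=
  PresentedGroup.toGroup (f := fun v => (Γ.reflect_involutive v).toPerm) (by
    rintro r (⟨v, rfl⟩ | ⟨u, v, h, rfl⟩)
    · ext f : 1
      simpa [pow_two] using Γ.reflect_involutive v f
    · rw [map_mul, map_mul, map_mul, map_inv, map_inv, mul_inv_eq_one, mul_inv_eq_iff_eq_mul]
      ext f : 1
      simpa using Γ.reflect_comm h f)

theorem dualRep_of (v : V) (f : V → ℤ) :
    Γ.dualRep (PresentedGroup.of v) f = Γ.reflect v f := by
  simp [dualRep]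

/-- The value in the right-angled Coxeter group of a word over the vertices. -/
noncomputable def racgValue (w : List V) : RACG Γ := (w.map fun v => PresentedGroup.of v).prod

@[simp] theorem racgValue_nil : Γ.racgValue [] = 1 := rfl

@[simp] theorem racgValue_cons (v : V) (w : List V) :
    Γ.racgValue (v :: w) = PresentedGroup.of v * Γ.racgValue w := by simp [racgValue]

theorem of_mul_of_self (v : V) : (PresentedGroup.of v * PresentedGroup.of v : RACG Γ) = 1 := by
  have h : (PresentedGroup.mk (graphProductRelators Γ fun _ => 2)) (FreeGroup.of v ^ 2) = 1 :=
    PresentedGroup.one_of_mem (Or.inl ⟨v, rfl⟩)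
  rw [map_pow, pow_two] at h
  exact h

theorem of_inv (v : V) : (PresentedGroup.of v : RACG Γ)⁻¹ = PresentedGroup.of v :=
  inv_eq_of_mul_eq_one_left (Γ.of_mul_of_self v)

theorem of_comm {u v : V} (huv : Γ.Adj u v) :
    (PresentedGroup.of u * PresentedGroup.of v : RACG Γ) =
      PresentedGroup.of v * PresentedGroup.of u := by
  have h : (PresentedGroup.mk (graphProductRelators Γ fun _ => 2))
      (FreeGroup.of u * FreeGroup.of v * (FreeGroup.of u)⁻¹ * (FreeGroup.of v)⁻¹) = 1 :=
    PresentedGroup.one_of_mem (Or.inr ⟨u, v, huv, rfl⟩)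
  rw [map_mul, map_mul, map_mul, map_inv, map_inv, mul_inv_eq_one, mul_inv_eq_iff_eq_mul] at h
  exact h

/-- Applied to the all-one vector, `u` makes coordinate `u` equal to `-1`, while a generator `v ≠ u`
makes it `1` or `3`. -/
theorem of_injective : Function.Injective (PresentedGroup.of : V → RACG Γ) := by
  intro u v h
  by_contra hne
  have h1 : Γ.reflect u (fun _ => 1) u = Γ.reflect v (fun _ => 1) u := by
    rw [← dualRep_of, ← dualRep_of, h]
  rw [reflect_self] at h1
  by_cases h2 : Γ.Adj v u
  · rw [reflect_of_adj _ h2] at h1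
    omega
  · rw [reflect_of_not_adj _ hne h2] at h1
    omega

/-! ### Descent sets and reduced words -/

open Classical in
/-- The descent set of `v * g`, where `σ` is the descent set of `g` and `v ∉ σ`. -/
noncomputable def nextDescents (σ : Finset V) (v : V) : Finset V := insert v (σ.filter (Γ.Adj v))

theorem mem_nextDescents {σ : Finset V} {v x : V} :
    x ∈ Γ.nextDescents σ v ↔ x = v ∨ x ∈ σ ∧ Γ.Adj v x := by
  simp [nextDescents]

theorem isClique_nextDescents {σ : Finset V} (hσ : Γ.IsClique (σ : Set V)) (v : V) :
    Γ.IsClique (Γ.nextDescents σ v : Set V) := by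
  intro x hx y hy hxy
  rw [Finset.mem_coe, mem_nextDescents] at hx hy
  rcases hx with rfl | hx <;> rcases hy with rfl | hy
  · exact absurd rfl hxy
  · exact hy.2
  · exact hx.2.symm
  · exact hσ hx.1 hy.1 hxy

open Classical in
theorem card_nextDescents {σ : Finset V} {v : V} (hv : v ∉ σ) :
    (Γ.nextDescents σ v).card = (σ.filter (Γ.Adj v)).card + 1 :=
  Finset.card_insert_of_notMem fun h => hv (Finset.mem_of_mem_filter _ h)

/-- The left descent set of a reduced word over the vertices. -/
noncomputable def descents (w : List V) : Finset V := w.foldr (fun v σ => Γ.nextDescents σ v) ∅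

@[simp] theorem descents_nil : Γ.descents [] = ∅ := rfl

@[simp] theorem descents_cons (v : V) (w : List V) :
    Γ.descents (v :: w) = Γ.nextDescents (Γ.descents w) v := rfl

/-- Words in which no letter is a descent of the rest of the word. -/
def IsReducedWord : List V → Prop
  | [] => True
  | v :: w => v ∉ Γ.descents w ∧ IsReducedWord w

/-- A descent commutes with every letter in front of it, so it can be moved to the front. The
equation between descent sets is included because the induction needs it to see that the shortened
word is still reduced. -/
theorem IsReducedWord.exists_of_mem_descents {w : List V} (hw : Γ.IsReducedWord w) {x : V}
    (hx : x ∈ Γ.descents w) : ∃ u, Γ.IsReducedWord u ∧ u.length + 1 = w.length ∧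
      Γ.racgValue w = PresentedGroup.of x * Γ.racgValue u ∧ x ∉ Γ.descents u ∧
      Γ.descents w = Γ.nextDescents (Γ.descents u) x := by
  induction w with
  | nil => simp at hx
  | cons v w ih =>
    by_cases hxv : x = v
    · subst hxv
      exact ⟨w, hw.2, rfl, by simp, hw.1, rfl⟩
    · rw [descents_cons, mem_nextDescents] at hx
      obtain ⟨hx, hvx⟩ := hx.resolve_left hxv
      obtain ⟨u, hu, hl, hval, hxu, hd⟩ := ih hw.2 hx
      refine ⟨v :: u, ⟨?_, hu⟩, by simp [hl], ?_, ?_, ?_⟩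
      -- If `v` were a descent of `u`, it would remain one after putting the adjacent letter `x` in
      -- front, contradicting that `v :: w` is reduced.
      · intro hvu
        apply hw.1
        rw [hd, mem_nextDescents]
        exact Or.inr ⟨hvu, hvx.symm⟩
      · rw [racgValue_cons, racgValue_cons, hval, ← mul_assoc, ← mul_assoc, Γ.of_comm hvx]
      · rw [descents_cons, mem_nextDescents]
        tauto
      · rw [descents_cons, descents_cons, hd]
        ext y
        simp only [mem_nextDescents]
        have := hvx.symm
        constructor
        · rintro (rfl | ⟨rfl | h, h'⟩) <;> tauto
        · rintro (rfl | ⟨rfl | h, h'⟩) <;> tauto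

/-! ### Reduced words are the geodesics -/

/-- The image under a word of the all-one vector, a point in the interior of the fundamental
chamber. -/
noncomputable def chamberPoint (w : List V) : V → ℤ := Γ.dualRep (Γ.racgValue w) fun _ => 1

theorem chamberPoint_eq_reflect {w u : List V} {v : V}
    (h : Γ.racgValue w = PresentedGroup.of v * Γ.racgValue u) :
    Γ.chamberPoint w = Γ.reflect v (Γ.chamberPoint u) := by
  rw [chamberPoint, h, map_mul, Equiv.Perm.mul_apply, dualRep_of, chamberPoint]

/-- The bound on non-adjacent pairs carries the induction: a letter `v` sends a non-adjacent
coordinate `f x` to `(f x + f v) + f v`, where `f x` alone may be negative. -/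
theorem IsReducedWord.chamberPoint_pos (n : ℕ) : ∀ w : List V, w.length = n →
    Γ.IsReducedWord w → (∀ x, x ∉ Γ.descents w → 0 < Γ.chamberPoint w x) ∧
      ∀ x y, x ≠ y → ¬ Γ.Adj x y → 0 < Γ.chamberPoint w x + Γ.chamberPoint w y := by
  induction n using Nat.strong_induction_on with
  | _ n ih =>
    intro w hn hw
    have ha : ∀ x, x ∉ Γ.descents w → 0 < Γ.chamberPoint w x := by
      intro x hx
      cases w with
      | nil => simp [chamberPoint]
      | cons v w =>
        obtain ⟨h1, h2⟩ := ih w.length (by simp at hn; omega) w rfl hw.2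
        rw [Γ.chamberPoint_eq_reflect (Γ.racgValue_cons v w)]
        rw [descents_cons, mem_nextDescents, not_or] at hx
        by_cases hvx : Γ.Adj v x
        · rw [reflect_of_adj _ hvx]
          exact h1 x fun h => hx.2 ⟨h, hvx⟩
        · rw [reflect_of_not_adj _ hx.1 hvx]
          have := h1 v hw.1
          have := h2 v x (Ne.symm hx.1) hvx
          omega
    have hb : ∀ x y, x ≠ y → ¬ Γ.Adj x y → x ∈ Γ.descents w →
        0 < Γ.chamberPoint w x + Γ.chamberPoint w y := by
      intro x y hxy hadj hx
      -- Undoing the descent `x` leaves the sum unchanged: `-f x + (f y + 2 f x) = f x + f y`.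
      obtain ⟨u, hu, hl, hval, -, -⟩ := hw.exists_of_mem_descents Γ hx
      have := (ih u.length (by omega) u rfl hu).2 x y hxy hadj
      rw [Γ.chamberPoint_eq_reflect hval, reflect_self,
        reflect_of_not_adj _ hxy.symm hadj]
      omega
    refine ⟨ha, fun x y hxy hadj => ?_⟩
    by_cases hx : x ∈ Γ.descents w
    · exact hb x y hxy hadj hx
    · by_cases hy : y ∈ Γ.descents w
      · rw [add_comm]
        exact hb y x hxy.symm (fun h => hadj h.symm) hy
      · exact add_pos (ha x hx) (ha y hy)

/-- Words over the vertices that are geodesic in the right-angled Coxeter group. -/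
def IsGeodesicWord (w : List V) : Prop :=
  ∀ u : List V, Γ.racgValue u = Γ.racgValue w → w.length ≤ u.length

theorem exists_isGeodesicWord (w : List V) :
    ∃ u, Γ.IsGeodesicWord u ∧ Γ.racgValue u = Γ.racgValue w ∧ u.length ≤ w.length := by
  obtain ⟨u, hu, hmin⟩ := exists_minimalFor_of_wellFoundedLT
    (fun u => Γ.racgValue u = Γ.racgValue w) List.length ⟨w, rfl⟩
  have hle : ∀ y, Γ.racgValue y = Γ.racgValue w → u.length ≤ y.length := fun y hy =>
    (le_total y.length u.length).elim (fun h => hmin hy h) id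
  exact ⟨u, fun y hy => hle y (hy.trans hu), hu, hle w rfl⟩

theorem IsGeodesicWord.isReducedWord {w : List V} (hw : Γ.IsGeodesicWord w) :
    Γ.IsReducedWord w := by
  induction w with
  | nil => trivial
  | cons v w ih =>
    have hr := ih fun u hu => by simpa using hw (v :: u) (by simp [hu])
    refine ⟨fun hv => ?_, hr⟩
    obtain ⟨u, -, hl, hval, -, -⟩ := hr.exists_of_mem_descents Γ hv
    have := hw u (by rw [racgValue_cons, hval, ← mul_assoc, of_mul_of_self, one_mul])
    simp at this
    omega

/-- Compare with a shorter geodesic `u` of the same value. If `v` is a descent of `u`, cancelling it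
gives a word too short for the geodesic `w`. Otherwise coordinate `v` is positive at the chamber
point of `u`, yet it is minus the positive coordinate `v` at that of `w`. -/
theorem IsReducedWord.isGeodesicWord {w : List V} (hw : Γ.IsReducedWord w) :
    Γ.IsGeodesicWord w := by
  induction w with
  | nil => exact fun u _ => Nat.zero_le _
  | cons v w ih =>
    by_contra hng
    obtain ⟨u, hu, hval, hlen⟩ := Γ.exists_isGeodesicWord (v :: w)
    have hlt : u.length ≤ w.length := by
      by_contra h
      refine hng fun y hy => ?_
      have := hu y (hy.trans hval.symm)
      simp
      omega
    have hur := hu.isReducedWord Γ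
    rw [racgValue_cons] at hval
    by_cases hv : v ∈ Γ.descents u
    · obtain ⟨y, -, hl, hy, -, -⟩ := hur.exists_of_mem_descents Γ hv
      have := ih hw.2 y (mul_left_cancel (hy.symm.trans hval))
      omega
    · have h1 := (IsReducedWord.chamberPoint_pos Γ _ u rfl hur).1 v hv
      have h2 := (IsReducedWord.chamberPoint_pos Γ _ w rfl hw.2).1 v hw.1
      rw [Γ.chamberPoint_eq_reflect hval, reflect_self] at h1
      omega

theorem isGeodesicWord_iff {w : List V} : Γ.IsGeodesicWord w ↔ Γ.IsReducedWord w :=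
  ⟨fun h => h.isReducedWord Γ, fun h => h.isGeodesicWord Γ⟩

/-! ### Geodesics as paths in an automaton of cliques -/

/-- The vertices as elements of the standard generating set. -/
noncomputable def vertexEquiv : V ≃ RACG.standardGenerators Γ :=
  Equiv.ofBijective (fun v => ⟨PresentedGroup.of v, v, Or.inl rfl⟩) (by
    refine ⟨fun u v h => Γ.of_injective (Subtype.ext_iff.1 h), ?_⟩
    rintro ⟨g, v, rfl | rfl⟩
    · exact ⟨v, rfl⟩
    · exact ⟨v, Subtype.ext (Γ.of_inv v).symm⟩)

theorem wordValue_map_vertexEquiv (w : List V) :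
    wordValue (w.map Γ.vertexEquiv) = Γ.racgValue w := by
  rw [wordValue, racgValue, List.map_map]
  rfl

theorem map_vertexEquiv_mem_geodesicLanguage {w : List V} :
    w.map Γ.vertexEquiv ∈ geodesicLanguage (RACG.standardGenerators Γ) ↔ Γ.IsReducedWord w := by
  rw [← isGeodesicWord_iff]
  constructor
  · intro h u hu
    simpa using h (u.map Γ.vertexEquiv) (by simpa [wordValue_map_vertexEquiv] using hu)
  · intro h y hy
    obtain ⟨u, rfl⟩ : ∃ u : List V, u.map Γ.vertexEquiv = y :=
      List.map_surjective_iff.2 Γ.vertexEquiv.surjective y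
    simpa using h u (by simpa [wordValue_map_vertexEquiv] using hy)

/-- Words `w` such that `w.reverse` may be put in front of a word with descent set `σ`. -/
def Extends (σ : Finset V) : List V → Prop
  | [] => True
  | v :: w => v ∉ σ ∧ Extends (Γ.nextDescents σ v) w

theorem extends_append (σ : Finset V) (u w : List V) : Γ.Extends σ (u ++ w) ↔
    Γ.Extends σ u ∧ Γ.Extends (u.foldl Γ.nextDescents σ) w := by
  induction u generalizing σ with
  | nil => simp [Extends]
  | cons v u ih => simp [Extends, ih, and_assoc]

theorem extends_reverse (w : List V) : Γ.Extends ∅ w.reverse ↔ Γ.IsReducedWord w := by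
  induction w with
  | nil => simp [Extends, IsReducedWord]
  | cons v w ih =>
    rw [List.reverse_cons, extends_append, ih, List.foldl_reverse]
    simp only [Extends, IsReducedWord, and_true, descents]
    exact and_comm

theorem ncard_geodesicLanguage (n : ℕ) :
    Set.ncard {x | x ∈ geodesicLanguage (RACG.standardGenerators Γ) ∧ x.length = n} =
      Set.ncard {w : List V | Γ.Extends ∅ w ∧ w.length = n} := by
  symm
  refine Set.ncard_congr (fun w _ => w.reverse.map Γ.vertexEquiv) ?_ ?_ ?_
  · rintro w ⟨hw, rfl⟩
    refine ⟨Γ.map_vertexEquiv_mem_geodesicLanguage.2 ?_, by simp⟩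
    rw [← extends_reverse, List.reverse_reverse]
    exact hw
  · intro w w' _ _ h
    exact List.reverse_injective (List.map_injective_iff.2 Γ.vertexEquiv.injective h)
  · rintro y ⟨hy, rfl⟩
    obtain ⟨u, rfl⟩ : ∃ u : List V, u.map Γ.vertexEquiv = y :=
      List.map_surjective_iff.2 Γ.vertexEquiv.surjective y
    refine ⟨u.reverse, ⟨?_, by simp⟩, by simp⟩
    rw [extends_reverse]
    exact Γ.map_vertexEquiv_mem_geodesicLanguage.1 hy

theorem finite_extends [Finite V] (σ : Finset V) (n : ℕ) :
    {w : List V | Γ.Extends σ w ∧ w.length = n}.Finite :=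
  (List.finite_length_eq V n).subset fun _ h => h.2

open Classical in
theorem ncard_extends_succ [Fintype V] (σ : Finset V) (n : ℕ) :
    Set.ncard {w : List V | Γ.Extends σ w ∧ w.length = n + 1} =
      ∑ v ∈ Finset.univ.filter (· ∉ σ),
        Set.ncard {w : List V | Γ.Extends (Γ.nextDescents σ v) w ∧ w.length = n} := by
  have h : {w : List V | Γ.Extends σ w ∧ w.length = n + 1} =
      ⋃ v ∈ ((Finset.univ.filter (· ∉ σ) : Finset V) : Set V),
        List.cons v '' {w : List V | Γ.Extends (Γ.nextDescents σ v) w ∧ w.length = n} := by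
    ext w
    cases w with
    | nil => simp
    | cons v w => simp [Extends]; tauto
  rw [h, Set.Finite.ncard_biUnion (Finset.finite_toSet _), finsum_mem_coe_finset]
  · exact Finset.sum_congr rfl fun v _ => Set.ncard_image_of_injective _ List.cons_injective
  · exact fun v _ => (Γ.finite_extends _ n).image _
  · intro v _ v' _ hne
    rw [Function.onFun, Set.disjoint_left]
    rintro _ ⟨w, _, rfl⟩ ⟨w', _, h⟩
    exact hne (List.cons.inj h).1.symm

end SimpleGraph

/-! ### Binomial inversion and the coefficients `N` -/

/-- Since `C(m,i) C(i,j) = C(m,j) C(m-j,i-j)`, this reduces to an alternating row sum of Pascal's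
triangle; the terms with `i > m` vanish. -/
theorem sum_Icc_neg_one_pow_mul_choose_mul_choose {m j k : ℕ} (hm : m ≤ k) :
    ∑ i ∈ Finset.Icc j k, (-1 : ℤ) ^ (i - j) * (i.choose j : ℤ) * (m.choose i : ℤ) =
      if m = j then 1 else 0 := by
  have h1 : ∀ i ∈ Finset.Icc j k, (-1 : ℤ) ^ (i - j) * (i.choose j : ℤ) * (m.choose i : ℤ) =
      (m.choose j : ℤ) * ((-1) ^ (i - j) * ((m - j).choose (i - j) : ℤ)) := by
    intro i hi
    have := Nat.choose_mul (n := m) (Finset.mem_Icc.1 hi).1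
    zify at this
    linear_combination (-1 : ℤ) ^ (i - j) * this
  rw [Finset.sum_congr rfl h1, ← Finset.mul_sum]
  rcases lt_or_ge m j with hmj | hmj
  · rw [Nat.choose_eq_zero_of_lt hmj, if_neg hmj.ne]
    simp
  · have h2 : ∑ i ∈ Finset.Icc j k, (-1 : ℤ) ^ (i - j) * ((m - j).choose (i - j) : ℤ) =
        ∑ i ∈ Finset.range (m - j + 1), (-1 : ℤ) ^ i * ((m - j).choose i : ℤ) := by
      rw [← Finset.Ico_add_one_right_eq_Icc, Finset.sum_Ico_eq_sum_range]
      simp only [Nat.add_sub_cancel_left]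
      symm
      refine Finset.sum_subset (Finset.range_subset_range.2 (by omega)) fun i _ hi => ?_
      rw [Nat.choose_eq_zero_of_lt (by simpa using hi)]
      simp
    rw [h2, Int.alternating_sum_range_choose]
    by_cases h : m = j
    · simp [h]
    · rw [if_neg (by omega), if_neg h, mul_zero]

/-- Binomial inversion: the number of points at which a function takes the value `j` in terms of
the binomial moments of the function. -/
theorem card_filter_eq_of_binomial_moments {ι : Type*} (W : Finset ι) (a : ι → ℕ) (k : ℕ)
    (ha : ∀ v ∈ W, a v ≤ k) (c : ℕ → ℤ)
    (hc : ∀ i ≤ k, ∑ v ∈ W, ((a v).choose i : ℤ) = (k.choose i : ℤ) * c i) (j : ℕ) :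
    ((W.filter fun v => a v = j).card : ℤ) = (k.choose j : ℤ) *
      ∑ i ∈ Finset.Icc j k, ((k - j).choose (i - j) : ℤ) * (-1) ^ (i - j) * c i := by
  rw [Finset.card_filter, Nat.cast_sum]
  have h1 : ∀ v ∈ W, ((if a v = j then 1 else 0 : ℕ) : ℤ) =
      ∑ i ∈ Finset.Icc j k, (-1 : ℤ) ^ (i - j) * (i.choose j : ℤ) * ((a v).choose i : ℤ) := by
    intro v hv
    rw [sum_Icc_neg_one_pow_mul_choose_mul_choose (ha v hv)]
    split_ifs <;> simp
  rw [Finset.sum_congr rfl h1, Finset.sum_comm, Finset.mul_sum]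
  refine Finset.sum_congr rfl fun i hi => ?_
  rw [Finset.mem_Icc] at hi
  rw [← Finset.mul_sum, hc i hi.2]
  have := Nat.choose_mul (n := k) hi.1
  zify at this
  linear_combination (-1 : ℤ) ^ (i - j) * c i * this

/-- In a link-regular graph, the number of vertices `v` outside a `k`-clique `σ` whose
neighbourhood meets `σ` in a given set of size `j`. -/
def transitionCoeff (ℓ : ℕ → ℕ) (k j : ℕ) : ℤ :=
  ∑ i ∈ Finset.Icc j k, ((k - j).choose (i - j) : ℤ) * (-1) ^ (i - j) * ((ℓ i : ℤ) - (k - i : ℕ))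

theorem transitionCoeff_self (ℓ : ℕ → ℕ) (k : ℕ) : transitionCoeff ℓ k k = ℓ k := by
  simp [transitionCoeff]

/-- A finite difference of order at least two kills a linear function. -/
theorem sum_choose_mul_neg_one_pow_mul_sub {n : ℕ} (hn : 2 ≤ n) :
    ∑ r ∈ Finset.range (n + 1), (n.choose r : ℤ) * (-1) ^ r * ((n - r : ℕ) : ℤ) = 0 := by
  obtain ⟨m, rfl⟩ := Nat.exists_eq_add_of_le' hn
  rw [Finset.sum_range_succ, Nat.sub_self, Nat.cast_zero, mul_zero, add_zero]
  have h : ∀ r ∈ Finset.range (m + 2), ((m + 2).choose r : ℤ) * (-1) ^ r * ((m + 2 - r : ℕ) : ℤ) =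
      (m + 2 : ℤ) * ((-1) ^ r * ((m + 1).choose r : ℤ)) := by
    intro r _
    have := Nat.choose_mul_succ_eq (m + 1) r
    zify at this
    linear_combination -(-1 : ℤ) ^ r * this
  rw [Finset.sum_congr rfl h, ← Finset.mul_sum, Int.alternating_sum_range_choose]
  simp

/-- The correction `-(m - i)` in `transitionCoeff` contributes `-1` when `m = k + 1` and nothing
when the gap is larger, which explains the separate case in the definition of `N`. -/
theorem coeffN_eq_prod_mul_transitionCoeff (ℓ : ℕ → ℕ) {m k : ℕ} (h : k < m) :
    coeffN ℓ m k = (∏ j ∈ Finset.Ioo k m, (ℓ j : ℤ)) * transitionCoeff ℓ m k := by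
  rw [coeffN, if_neg h.ne]
  split_ifs with h1
  · subst h1
    have hI : Finset.Ioo k (k + 1) = ∅ := by ext; simp
    have hJ : Finset.Icc k (k + 1) = {k, k + 1} := by ext; simp; omega
    rw [transitionCoeff, hI, hJ]
    simp
    ring
  · congr 1
    rw [transitionCoeff, ← sub_eq_zero, ← Finset.sum_sub_distrib,
      ← sum_choose_mul_neg_one_pow_mul_sub (n := m - k) (by omega),
      ← Finset.Ico_add_one_right_eq_Icc, Finset.sum_Ico_eq_sum_range,
      show m + 1 - k = m - k + 1 by omega]
    refine Finset.sum_congr rfl fun r _ => ?_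
    rw [Nat.add_sub_cancel_left, show m - (k + r) = m - k - r by omega]
    ring

/-! ### Counting transitions between cliques -/

namespace SimpleGraph

variable {V : Type*} [Fintype V] (Γ : SimpleGraph V)

-- These vertices form the part of the link of `ρ` outside `σ`, and all of `σ \ ρ` lies in that link
-- because `σ` is a clique.
open Classical in
theorem card_filter_subset_eq {σ ρ : Finset V} (hσ : Γ.IsClique (σ : Set V)) (hρ : ρ ⊆ σ) :
    (((Finset.univ.filter (· ∉ σ)).filter fun v => ρ ⊆ σ.filter (Γ.Adj v)).card : ℤ) =
      (Γ.cliqueLink ρ).card - (σ.card - ρ.card : ℕ) := by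
  have h : (Finset.univ.filter (· ∉ σ)).filter (fun v => ρ ⊆ σ.filter (Γ.Adj v)) =
      Γ.cliqueLink ρ \ (σ \ ρ) := by
    ext v
    have hρc : Γ.IsClique (ρ : Set V) := hσ.subset (Finset.coe_subset.2 hρ)
    simp only [cliqueLink, Finset.mem_filter, Finset.mem_univ, true_and, Finset.mem_sdiff,
      Finset.coe_insert, isClique_insert, Finset.mem_coe, Finset.subset_iff]
    constructor
    · rintro ⟨h1, h2⟩
      exact ⟨⟨fun h => h1 (hρ h), hρc, fun b hb _ => (h2 hb).2⟩, fun h => h1 h.1⟩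
    · rintro ⟨⟨h1, -, h2⟩, h3⟩
      refine ⟨fun h => h3 ⟨h, h1⟩, fun x hx => ⟨hρ hx, h2 x hx ?_⟩⟩
      rintro rfl
      exact h1 hx
  have hsub : σ \ ρ ⊆ Γ.cliqueLink ρ := by
    intro v hv
    rw [Finset.mem_sdiff] at hv
    simp only [cliqueLink, Finset.mem_filter, Finset.mem_univ, true_and]
    refine ⟨hv.2, hσ.subset ?_⟩
    rw [Finset.coe_subset]
    exact Finset.insert_subset hv.1 hρ
  rw [h, Finset.card_sdiff_of_subset hsub, Nat.cast_sub (Finset.card_le_card hsub),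
    Finset.card_sdiff_of_subset hρ]

open Classical in
theorem card_filter_card_eq (ℓ : ℕ → ℕ) {σ : Finset V} (hσ : Γ.IsClique (σ : Set V))
    (hℓ : ∀ ρ ⊆ σ, ℓ ρ.card = (Γ.cliqueLink ρ).card) (j : ℕ) :
    (((Finset.univ.filter (· ∉ σ)).filter fun v => (σ.filter (Γ.Adj v)).card = j).card : ℤ) =
      (σ.card.choose j : ℤ) * transitionCoeff ℓ σ.card j := by
  refine card_filter_eq_of_binomial_moments _ (fun v => (σ.filter (Γ.Adj v)).card) σ.card
    (fun v _ => Finset.card_filter_le _ _) (fun i => (ℓ i : ℤ) - (σ.card - i : ℕ)) ?_ j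
  intro i _
  -- The `i`-th binomial moment counts pairs of a vertex `v ∉ σ` and an `i`-subset `ρ` of `σ`
  -- adjacent to `v`; each `ρ` contributes the same number.
  have h1 : ∀ v ∈ Finset.univ.filter (· ∉ σ), (((σ.filter (Γ.Adj v)).card.choose i : ℕ) : ℤ) =
      ∑ ρ ∈ σ.powersetCard i, if ρ ⊆ σ.filter (Γ.Adj v) then 1 else 0 := by
    intro v _
    rw [← Finset.card_powersetCard, Finset.sum_boole]
    congr 2
    ext ρ
    simp only [Finset.mem_powersetCard, Finset.mem_filter]
    exact ⟨fun h => ⟨⟨h.1.trans (Finset.filter_subset _ _), h.2⟩, h.1⟩,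
      fun h => ⟨h.2, h.1.2⟩⟩
  rw [Finset.sum_congr rfl h1, Finset.sum_comm]
  have h2 : ∀ ρ ∈ σ.powersetCard i, (∑ v ∈ Finset.univ.filter (· ∉ σ),
      if ρ ⊆ σ.filter (Γ.Adj v) then (1 : ℤ) else 0) = (ℓ i : ℤ) - (σ.card - i : ℕ) := by
    intro ρ hρ
    rw [Finset.mem_powersetCard] at hρ
    have := Γ.card_filter_subset_eq hσ hρ.1
    rw [← hρ.2, hℓ ρ hρ.1, ← this, Finset.card_filter]
    push_cast
    rfl
  rw [Finset.sum_congr rfl h2, Finset.sum_const, Finset.card_powersetCard, nsmul_eq_mul]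

end SimpleGraph

/-- The number of ways to extend a geodesic word with descent set of size `k` by `n` letters. -/
def extensionCount (ℓ : ℕ → ℕ) : ℕ → ℕ → ℤ
  | 0, _ => 1
  | n + 1, k => ∑ j ∈ Finset.range (k + 1),
      (k.choose j : ℤ) * transitionCoeff ℓ k j * extensionCount ℓ n (j + 1)

theorem SimpleGraph.ncard_extends {V : Type*} [Fintype V] (Γ : SimpleGraph V) (ℓ : ℕ → ℕ)
    (hℓ : ∀ σ : Finset V, Γ.IsClique (σ : Set V) → ℓ σ.card = (Γ.cliqueLink σ).card) (n : ℕ) :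
    ∀ σ : Finset V, Γ.IsClique (σ : Set V) →
      (Set.ncard {w : List V | Γ.Extends σ w ∧ w.length = n} : ℤ) =
        extensionCount ℓ n σ.card := by
  classical
  induction n with
  | zero =>
    intro σ _
    have : {w : List V | Γ.Extends σ w ∧ w.length = 0} = {[]} := by
      ext w
      cases w <;> simp [Extends]
    rw [this, Set.ncard_singleton]
    rfl
  | succ n ih =>
    intro σ hσ
    rw [ncard_extends_succ, Nat.cast_sum, extensionCount]
    have h1 : ∀ v ∈ Finset.univ.filter (· ∉ σ),
        (Set.ncard {w : List V | Γ.Extends (Γ.nextDescents σ v) w ∧ w.length = n} : ℤ) =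
          extensionCount ℓ n ((σ.filter (Γ.Adj v)).card + 1) := by
      intro v hv
      rw [ih _ (Γ.isClique_nextDescents hσ v), card_nextDescents _ (Finset.mem_filter.1 hv).2]
    -- Group the letters by their number `j` of neighbours in `σ`; the next descent set then has
    -- size `j + 1`.
    rw [Finset.sum_congr (by congr!) h1, ← Finset.sum_fiberwise_of_maps_to
      (g := fun v => (σ.filter (Γ.Adj v)).card) (t := Finset.range (σ.card + 1))
      (fun v _ => Finset.mem_range.2 (Nat.lt_succ_of_le (Finset.card_filter_le _ _)))]
    refine Finset.sum_congr rfl fun j _ => ?_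
    rw [← Γ.card_filter_card_eq ℓ hσ
      (fun ρ hρ => hℓ ρ (hσ.subset (Finset.coe_subset.2 hρ))) j, ← nsmul_eq_mul,
      ← Finset.sum_const]
    refine Finset.sum_congr rfl fun v hv => ?_
    rw [(Finset.mem_filter.1 hv).2]

/-! ### Generating polynomials of interval sequences and the coefficients `M` -/

open Polynomial in
/-- The generating polynomial, by total length, of the sequences of `n` successive intervals
`[s, t]` between `j` and `d`, the interval `[s, t]` having the weight `-w t s`. -/
noncomputable def intervalPoly (w : ℕ → ℕ → ℤ) (d : ℕ) : ℕ → ℕ → ℤ[X]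
  | 0, _ => 1
  | n + 1, j => ∑ s ∈ Finset.Ico j d, ∑ t ∈ Finset.Ioc s d,
      (C (-w t s) * X ^ (t - s)) * intervalPoly w d n t

/-- The generating polynomial, by total length, of all sequences of successive intervals between
`j` and `d`. -/
noncomputable def intervalsPoly (w : ℕ → ℕ → ℤ) (d j : ℕ) : ℤ[X] :=
  ∑ n ∈ Finset.range (d + 1), intervalPoly w d n j

/-- Each interval has length at least one, so at most `d - j` of them fit. This makes the cutoff at
`d` intervals harmless when the first one is peeled off. -/
theorem intervalPoly_eq_zero (w : ℕ → ℕ → ℤ) {d n j : ℕ} (hj : j ≤ d) (h : d < n + j) :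
    intervalPoly w d n j = 0 := by
  induction n generalizing j with
  | zero => omega
  | succ n ih =>
    rw [intervalPoly]
    refine Finset.sum_eq_zero fun s hs => Finset.sum_eq_zero fun t ht => ?_
    rw [Finset.mem_Ico] at hs
    rw [Finset.mem_Ioc] at ht
    rw [ih ht.2 (by omega), mul_zero]

theorem natDegree_intervalPoly_le (w : ℕ → ℕ → ℤ) {d n j : ℕ} (hj : j ≤ d) :
    (intervalPoly w d n j).natDegree ≤ d - j := by
  induction n generalizing j with
  | zero => simp [intervalPoly]
  | succ n ih =>
    rw [intervalPoly]
    refine Polynomial.natDegree_sum_le_of_forall_le _ _ fun s hs =>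
      Polynomial.natDegree_sum_le_of_forall_le _ _ fun t ht => ?_
    rw [Finset.mem_Ico] at hs
    rw [Finset.mem_Ioc] at ht
    refine Polynomial.natDegree_mul_le.trans ?_
    have := Polynomial.natDegree_C_mul_X_pow_le (-w t s) (t - s)
    have := ih ht.2
    omega

theorem natDegree_intervalsPoly_le (w : ℕ → ℕ → ℤ) {d j : ℕ} (hj : j ≤ d) :
    (intervalsPoly w d j).natDegree ≤ d - j :=
  Polynomial.natDegree_sum_le_of_forall_le _ _ fun _ _ => natDegree_intervalPoly_le w hj

open Polynomial in
theorem intervalsPoly_eq_one_add (w : ℕ → ℕ → ℤ) (d j : ℕ) :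
    intervalsPoly w d j = 1 + ∑ s ∈ Finset.Ico j d, ∑ t ∈ Finset.Ioc s d,
      (C (-w t s) * X ^ (t - s)) * intervalsPoly w d t := by
  have h : ∀ s ∈ Finset.Ico j d, ∀ t ∈ Finset.Ioc s d,
      (C (-w t s) * X ^ (t - s)) * intervalsPoly w d t =
      ∑ n ∈ Finset.range d, (C (-w t s) * X ^ (t - s)) * intervalPoly w d n t := by
    intro s hs t ht
    rw [Finset.mem_Ioc] at ht
    rw [← Finset.mul_sum, intervalsPoly, Finset.sum_range_succ,
      intervalPoly_eq_zero w ht.2 (by omega), add_zero]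
  rw [Finset.sum_congr rfl fun s hs => (Finset.sum_congr rfl (h s hs)).trans Finset.sum_comm,
    Finset.sum_comm, intervalsPoly, Finset.sum_range_succ', add_comm]
  rfl

-- Either the first interval starts after `j`, or is absent, or it is `[j, t]` and the rest starts
-- from `t`.
open Polynomial in
theorem intervalsPoly_eq_add {w : ℕ → ℕ → ℤ} {d j : ℕ} (hj : j < d) :
    intervalsPoly w d j = intervalsPoly w d (j + 1) +
      ∑ t ∈ Finset.Ioc j d, (C (-w t j) * X ^ (t - j)) * intervalsPoly w d t := by
  rw [intervalsPoly_eq_one_add w d j, intervalsPoly_eq_one_add w d (j + 1),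
    Finset.sum_eq_sum_Ico_succ_bot hj]
  ring

theorem coeff_zero_intervalsPoly (w : ℕ → ℕ → ℤ) (d j : ℕ) :
    (intervalsPoly w d j).coeff 0 = 1 := by
  rw [intervalsPoly_eq_one_add, Polynomial.coeff_add, Polynomial.coeff_one_zero,
    Polynomial.finsetSum_coeff, Finset.sum_eq_zero, add_zero]
  intro s _
  rw [Polynomial.finsetSum_coeff]
  refine Finset.sum_eq_zero fun t ht => ?_
  have : t - s ≠ 0 := by
    rw [Finset.mem_Ioc] at ht
    omega
  simp [Polynomial.mul_coeff_zero, this.symm]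

/-- The pairs `(p a).1 < (p a).2` are successive intervals between `j` and `d`. -/
def IsIntervalSeq (d j n : ℕ) (p : Fin n → ℕ × ℕ) : Prop :=
  (∀ a, j ≤ (p a).1 ∧ (p a).1 < (p a).2 ∧ (p a).2 ≤ d) ∧ ∀ a b, a < b → (p a).2 ≤ (p b).1

theorem isIntervalSeq_cons {d j n : ℕ} {q : ℕ × ℕ} {p : Fin n → ℕ × ℕ} :
    IsIntervalSeq d j (n + 1) (Fin.cons q p : Fin (n + 1) → ℕ × ℕ) ↔
      (j ≤ q.1 ∧ q.1 < q.2 ∧ q.2 ≤ d) ∧ IsIntervalSeq d q.2 n p := by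
  simp only [IsIntervalSeq, Fin.forall_fin_succ, Fin.cons_zero, Fin.cons_succ,
    Fin.succ_lt_succ_iff, Fin.succ_pos, Fin.not_lt_zero, false_imp_iff, true_imp_iff, true_and]
  constructor
  · rintro ⟨⟨h1, h2⟩, h3, h4⟩
    exact ⟨h1, fun a => ⟨h3 a, (h2 a).2⟩, h4⟩
  · rintro ⟨h1, h2, h3⟩
    exact ⟨⟨h1, fun a => ⟨by have := (h2 a).1; omega, (h2 a).2⟩⟩, fun a => (h2 a).1, h3⟩

open Polynomial Classical in
theorem intervalPoly_eq_sum (w : ℕ → ℕ → ℤ) (d n j : ℕ) : intervalPoly w d n j =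
    ∑ p ∈ (Fintype.piFinset fun _ : Fin n =>
        Finset.range (d + 1) ×ˢ Finset.range (d + 1)) with IsIntervalSeq d j n p,
      ∏ a, (C (-w (p a).2 (p a).1) * X ^ ((p a).2 - (p a).1)) := by
  induction n generalizing j with
  | zero =>
    rw [Finset.filter_true_of_mem fun p _ => ⟨fun a => a.elim0, fun a => a.elim0⟩]
    simp [intervalPoly]
  | succ n ih =>
    rw [intervalPoly]
    simp only [ih, Finset.mul_sum]
    rw [Finset.sum_sigma', Finset.sum_sigma']
    refine Finset.sum_nbij' (fun x => Fin.cons (x.1.1, x.1.2) x.2)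
      (fun p => ⟨⟨(p 0).1, (p 0).2⟩, Fin.tail p⟩) ?_ ?_ ?_ ?_ ?_
    · rintro ⟨⟨s, t⟩, p⟩ h
      simp only [Finset.mem_sigma, Finset.mem_Ico, Finset.mem_Ioc, Finset.mem_filter,
        Fintype.mem_piFinset, Finset.mem_product, Finset.mem_range] at h ⊢
      refine ⟨Fin.forall_fin_succ.2 ⟨?_, fun a => ?_⟩, isIntervalSeq_cons.2 ⟨?_, h.2.2⟩⟩
      · simp only [Fin.cons_zero]
        omega
      · simpa using h.2.1 a
      · simp only
        omega
    · intro p h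
      rw [← Fin.cons_self_tail p, Finset.mem_filter, isIntervalSeq_cons] at h
      simp only [Finset.mem_sigma, Finset.mem_Ico, Finset.mem_Ioc, Finset.mem_filter,
        Fintype.mem_piFinset] at h ⊢
      refine ⟨⟨?_, ?_⟩, fun a => by simpa using h.1 a.succ, h.2.2⟩ <;> omega
    · rintro ⟨⟨s, t⟩, p⟩ _
      simp
    · intro p _
      simp
    · rintro ⟨⟨s, t⟩, p⟩ _
      rw [Fin.prod_univ_succ]
      simp

open Polynomial Classical in
theorem coeff_intervalPoly (w : ℕ → ℕ → ℤ) (d i j n : ℕ) : (intervalPoly w d n j).coeff (i - j) =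
    ∑ p ∈ (Fintype.piFinset fun _ : Fin n =>
        Finset.range (d + 1) ×ˢ Finset.range (d + 1)) with
          IsInterlacing d i j n (fun a => (p a).1) (fun a => (p a).2),
      (-1) ^ n * ∏ a, w (p a).2 (p a).1 := by
  have h : ∀ p : Fin n → ℕ × ℕ, IsInterlacing d i j n (fun a => (p a).1) (fun a => (p a).2) ↔
      IsIntervalSeq d j n p ∧ i - j = ∑ a, ((p a).2 - (p a).1) := fun p => by
    rw [IsInterlacing, IsIntervalSeq, and_assoc, eq_comm (a := i - j)]
  simp only [h]
  rw [intervalPoly_eq_sum, finsetSum_coeff, ← Finset.filter_filter]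
  refine Eq.trans ?_ (Finset.sum_filter _ _).symm
  refine Finset.sum_congr rfl fun p _ => ?_
  rw [Finset.prod_mul_distrib, Finset.prod_pow_eq_pow_sum, ← map_prod, coeff_C_mul_X_pow,
    Finset.prod_neg]
  simp

theorem coeffM_eq_coeff (ℓ : ℕ → ℕ) (d i j : ℕ) (hij : j ≤ i) : coeffM ℓ d i j =
    (intervalsPoly (fun t s => (t.choose s : ℤ) * coeffN ℓ t s) d j).coeff (i - j) := by
  rw [coeffM]
  split_ifs with h
  · subst h
    rw [Nat.sub_self, coeff_zero_intervalsPoly]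
  · rw [intervalsPoly, Polynomial.finsetSum_coeff]
    refine Finset.sum_congr rfl fun n _ => ?_
    rw [coeff_intervalPoly]

/-! ### Solving the system for the extension series -/

/-- Solution of a triangular linear system by telescoping against the solution `D` of the adjoint
system. -/
theorem mul_eq_sum_of_adjoint_recurrence {R : Type*} [CommRing R] {d : ℕ} {H D c : ℕ → R}
    {a : ℕ → ℕ → R} (hH : ∀ k, H k = c k + H (k + 1) + ∑ j ∈ Finset.range k, a k j * H (j + 1))
    (hD : ∀ j < d, D j = D (j + 1) + ∑ t ∈ Finset.Ioc j d, -a t j * D t) (hd : H (d + 1) = 0) :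
    H 0 * D 0 = ∑ k ∈ Finset.range (d + 1), c k * D k := by
  -- Exchanging the sums lets the recurrence for `D` absorb all the coefficients `a`; only
  -- differences of consecutive `D` remain.
  have h1 : ∑ k ∈ Finset.range (d + 1), (∑ j ∈ Finset.range k, a k j * H (j + 1)) * D k =
      ∑ j ∈ Finset.range d, H (j + 1) * (D (j + 1) - D j) := by
    simp only [Finset.sum_mul]
    rw [Finset.sum_comm' (t' := Finset.range d) (s' := fun j => Finset.Ioc j d)]
    · refine Finset.sum_congr rfl fun j hj => ?_
      rw [hD j (Finset.mem_range.1 hj), sub_add_cancel_left, ← Finset.sum_neg_distrib,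
        Finset.mul_sum]
      exact Finset.sum_congr rfl fun t _ => by ring
    · intro k j
      simp only [Finset.mem_range, Finset.mem_Ioc]
      omega
  have h2 : ∑ k ∈ Finset.range (d + 1), c k * D k = ∑ k ∈ Finset.range (d + 1), H k * D k -
      ∑ k ∈ Finset.range (d + 1), H (k + 1) * D k -
      ∑ k ∈ Finset.range (d + 1), (∑ j ∈ Finset.range k, a k j * H (j + 1)) * D k := by
    rw [← Finset.sum_sub_distrib, ← Finset.sum_sub_distrib]
    exact Finset.sum_congr rfl fun k _ => by linear_combination -D k * hH k
  rw [h2, h1, Finset.sum_range_succ', Finset.sum_range_succ (fun k => H (k + 1) * D k), hd]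
  simp only [mul_sub, Finset.sum_sub_distrib]
  ring

/-- The generating series of the extensions of a geodesic word with descent set of size `k`. -/
def extensionSeries (ℓ : ℕ → ℕ) (k : ℕ) : ℤ⟦X⟧ := PowerSeries.mk fun n => extensionCount ℓ n k

open PowerSeries in
theorem extensionSeries_eq (ℓ : ℕ → ℕ) (k : ℕ) : extensionSeries ℓ k =
    1 + X * ∑ j ∈ Finset.range (k + 1),
      C ((k.choose j : ℤ) * transitionCoeff ℓ k j) * extensionSeries ℓ (j + 1) := by
  ext n
  cases n with
  | zero => simp [extensionSeries, extensionCount]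
  | succ n =>
    simp only [extensionSeries, map_add, coeff_mk, extensionCount, coeff_succ_X_mul, map_sum,
      coeff_C_mul]
    simp [coeff_one]

open PowerSeries in
theorem extensionSeries_mul_intervalsPoly (ℓ : ℕ → ℕ) (d : ℕ) (hd : ℓ d = 0) :
    extensionSeries ℓ 0 *
      (intervalsPoly (fun t s => (t.choose s : ℤ) * coeffN ℓ t s) d 0 : ℤ⟦X⟧) =
    ∑ k ∈ Finset.range (d + 1), (C (∏ r ∈ Finset.range k, (ℓ r : ℤ)) * X ^ k) *
      (intervalsPoly (fun t s => (t.choose s : ℤ) * coeffN ℓ t s) d k : ℤ⟦X⟧) := by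
  -- The scaling of `H` turns the diagonal term `ℓ k` into `H (k + 1)`. For `j < k`, the scalings at
  -- `k` and `j + 1` differ by `ℓ_{j+1}⋯ℓ_{k-1} z^{k-j-1}`, whose product of links is the factor
  -- that makes `transitionCoeff` into `coeffN`.
  have h := mul_eq_sum_of_adjoint_recurrence (d := d)
    (H := fun k => C (∏ r ∈ Finset.range k, (ℓ r : ℤ)) * X ^ k * extensionSeries ℓ k)
    (D := fun k => (intervalsPoly (fun t s => (t.choose s : ℤ) * coeffN ℓ t s) d k : ℤ⟦X⟧))
    (c := fun k => C (∏ r ∈ Finset.range k, (ℓ r : ℤ)) * X ^ k)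
    (a := fun t s => C ((t.choose s : ℤ) * coeffN ℓ t s) * X ^ (t - s)) ?_ ?_ ?_
  · simpa using h
  · intro k
    have hterm : ∀ j ∈ Finset.range k,
        C ((k.choose j : ℤ) * coeffN ℓ k j) * X ^ (k - j) *
          (C (∏ r ∈ Finset.range (j + 1), (ℓ r : ℤ)) * X ^ (j + 1) *
            extensionSeries ℓ (j + 1)) =
        C (∏ r ∈ Finset.range k, (ℓ r : ℤ)) * X ^ k * (X *
          (C ((k.choose j : ℤ) * transitionCoeff ℓ k j) * extensionSeries ℓ (j + 1))) := by
      intro j hj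
      rw [Finset.mem_range] at hj
      have hprod : (∏ r ∈ Finset.range (j + 1), (ℓ r : ℤ)) * ∏ r ∈ Finset.Ioo j k, (ℓ r : ℤ) =
          ∏ r ∈ Finset.range k, (ℓ r : ℤ) := by
        rw [← Finset.prod_range_mul_prod_Ico _ (show j + 1 ≤ k by omega)]
        congr 1
      have hpow : (X : ℤ⟦X⟧) ^ (k - j) * X ^ (j + 1) = X ^ k * X := by
        rw [← pow_add, ← pow_succ]
        congr 1
        omega
      rw [coeffN_eq_prod_mul_transitionCoeff ℓ hj, ← hprod]
      simp only [map_mul]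
      linear_combination (C (k.choose j : ℤ) * C (transitionCoeff ℓ k j) *
        C (∏ r ∈ Finset.range (j + 1), (ℓ r : ℤ)) * C (∏ r ∈ Finset.Ioo j k, (ℓ r : ℤ)) *
        extensionSeries ℓ (j + 1)) * hpow
    rw [Finset.sum_congr rfl hterm, ← Finset.mul_sum, ← Finset.mul_sum]
    conv_lhs => rw [extensionSeries_eq, Finset.sum_range_succ, transitionCoeff_self]
    rw [Finset.prod_range_succ, Nat.choose_self]
    simp only [map_mul, Nat.cast_one, map_one]
    ring
  · intro j hj
    rw [intervalsPoly_eq_add hj, ← Polynomial.coeToPowerSeries.ringHom_apply, map_add, map_sum]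
    simp only [Polynomial.coeToPowerSeries.ringHom_apply, Polynomial.coe_mul, Polynomial.coe_pow,
      Polynomial.coe_X, Polynomial.coe_C, map_neg, neg_mul]
  -- The scaling at `d + 1` contains the factor `ℓ d = 0`, so the system closes.
  · simp [Finset.prod_range_succ, hd]

/-! ### Identification of numerator and denominator, and conclusion -/

open Polynomial in
theorem growthDenominator_eq_map (ℓ : ℕ → ℕ) (d : ℕ) : growthDenominator ℓ d =
    (intervalsPoly (fun t s => (t.choose s : ℤ) * coeffN ℓ t s) d 0).map
      (Int.castRingHom ℚ) := by
  rw [as_sum_range_C_mul_X_pow' (n := d + 1) (intervalsPoly _ d 0)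
    (Nat.lt_succ_of_le (natDegree_intervalsPoly_le _ (Nat.zero_le d))), growthDenominator,
    Polynomial.map_sum]
  refine Finset.sum_congr rfl fun i _ => ?_
  rw [coeffM_eq_coeff _ _ _ _ (Nat.zero_le i)]
  simp

open Polynomial in
theorem growthNumerator_eq_map (ℓ : ℕ → ℕ) (d : ℕ) : growthNumerator ℓ d =
    (∑ k ∈ Finset.range (d + 1), (C (∏ r ∈ Finset.range k, (ℓ r : ℤ)) * X ^ k) *
      intervalsPoly (fun t s => (t.choose s : ℤ) * coeffN ℓ t s) d k).map
        (Int.castRingHom ℚ) := by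
  ext i
  rw [growthNumerator, coeff_map, finsetSum_coeff, finsetSum_coeff]
  simp only [coeff_C_mul_X_pow]
  simp only [mul_assoc, coeff_C_mul, coeff_X_pow_mul', Int.coe_castRingHom]
  rw [Finset.sum_ite_eq (Finset.range (d + 1)) i]
  split_ifs with hi
  · rw [Finset.mem_range] at hi
    rw [Int.cast_inj]
    refine Finset.sum_subset_zero_on_sdiff (Finset.range_subset_range.2 (by omega)) ?_ ?_
    · intro k hk
      rw [if_neg, mul_zero]
      simp at hk
      omega
    · intro k hk
      have hk' : k ≤ i := Nat.lt_succ_iff.1 (Finset.mem_range.1 hk)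
      rw [if_pos hk', coeffM_eq_coeff _ _ _ _ hk']
  -- Beyond degree `d` both sides vanish: the `k`-th summand has degree at most `k + (d - k)`.
  · rw [Finset.sum_eq_zero, Int.cast_zero]
    intro k hk
    rw [Finset.mem_range] at hi hk
    rw [if_pos (by omega), coeff_eq_zero_of_natDegree_lt, mul_zero]
    have := natDegree_intervalsPoly_le (fun t s => (t.choose s : ℤ) * coeffN ℓ t s)
      (show k ≤ d by omega)
    omega

theorem SimpleGraph.cliqueLink_eq_empty {V : Type*} [Fintype V] {Γ : SimpleGraph V} {d : ℕ}
    (hd : IsGreatest {n : ℕ | ∃ σ : Finset V, Γ.IsNClique n σ} d) {σ : Finset V}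
    (hσ : σ.card = d) : Γ.cliqueLink σ = ∅ := by
  classical
  refine Finset.eq_empty_of_forall_notMem fun v hv => ?_
  simp only [cliqueLink, Finset.mem_filter, Finset.mem_univ, true_and] at hv
  have := hd.2 ⟨_, by convert hv.2, rfl⟩
  rw [Finset.card_insert_of_notMem hv.1] at this
  omega

theorem theorem6p4 {V : Type*} [Fintype V] (Γ : SimpleGraph V) (hΓ : Γ.IsLinkRegular)
    (d : ℕ) (hd : IsGreatest {n : ℕ | ∃ σ : Finset V, Γ.IsNClique n σ} d)
    (ℓ : ℕ → ℕ) (hℓ₀ : ℓ 0 = Fintype.card V)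
    (hℓ : ∀ k, 1 ≤ k → k ≤ d → ∀ σ : Finset V, Γ.IsNClique k σ → ℓ k = (Γ.cliqueLink σ).card) :
    (growthDenominator ℓ d).coeff 0 = 1 ∧
      RACG.geodesicGrowthSeries Γ =
        (growthNumerator ℓ d : ℚ⟦X⟧) * (growthDenominator ℓ d : ℚ⟦X⟧)⁻¹ := by
  have hlink : ∀ σ : Finset V, Γ.IsClique (σ : Set V) → ℓ σ.card = (Γ.cliqueLink σ).card := by
    intro σ hσ
    rcases Nat.eq_zero_or_pos σ.card with h0 | hpos
    · obtain rfl := Finset.card_eq_zero.1 h0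
      rw [Finset.card_empty, hℓ₀]
      simp [SimpleGraph.cliqueLink]
    · exact hℓ _ hpos (hd.2 ⟨σ, hσ, rfl⟩) σ ⟨hσ, rfl⟩
  have hℓd : ℓ d = 0 := by
    obtain ⟨σ, hσ⟩ := hd.1
    rw [← hσ.card_eq, hlink σ hσ.isClique, SimpleGraph.cliqueLink_eq_empty hd hσ.card_eq,
      Finset.card_empty]
  have hcoeff : (growthDenominator ℓ d).coeff 0 = 1 := by
    rw [growthDenominator_eq_map, Polynomial.coeff_map, coeff_zero_intervalsPoly, map_one]
  refine ⟨hcoeff, ?_⟩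
  have hseries : RACG.geodesicGrowthSeries Γ =
      PowerSeries.map (Int.castRingHom ℚ) (extensionSeries ℓ 0) := by
    ext n
    rw [RACG.geodesicGrowthSeries, growthSeries, PowerSeries.coeff_mk, PowerSeries.coeff_map,
      extensionSeries, PowerSeries.coeff_mk, Γ.ncard_geodesicLanguage,
      ← Finset.card_empty (α := V), ← Γ.ncard_extends ℓ hlink n ∅ (by simp)]
    simp
  rw [PowerSeries.eq_mul_inv_iff_mul_eq (by
      rw [← PowerSeries.coeff_zero_eq_constantCoeff_apply, Polynomial.coeff_coe, hcoeff]
      exact one_ne_zero),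
    hseries, growthDenominator_eq_map, growthNumerator_eq_map, Polynomial.polynomial_map_coe,
    Polynomial.polynomial_map_coe, ← map_mul, extensionSeries_mul_intervalsPoly ℓ d hℓd]
  congr 1
  rw [← Polynomial.coeToPowerSeries.ringHom_apply (φ := Finset.sum _ _), map_sum]
  simp only [Polynomial.coeToPowerSeries.ringHom_apply, Polynomial.coe_mul, Polynomial.coe_pow,
    Polynomial.coe_X, Polynomial.coe_C]
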